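/- Let $k$ be a number field with at least one real place. (1) For every integer $n \ge 2$ and every even integer $d \ge 4$ there exists a form (homogeneous polynomial) $f \in \mathbb{Q}[x_0,\dots,x_n]$ of degree $d$ which is a sum of two squares of forms in $\mathbb{R}[x_0,\dots,x_n]$, but is not a sum of (any finite number of) squares of forms in $k[x_0,\dots,x_n]$. (2) In particular, the analogue over $k$ of Hilbert's theorem on ternary quartics fails: there exists a form $g \in k[x_0,x_1,x_2]$ of degree $4$ which is nonnegative on $\mathbb{R}^3$ with respect to every embedding $k \hookrightarrow \mathbb{R}$, but is not a sum of squares of forms in $k[x_0,x_1,x_2]$. -/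

import Mathlib

/-- A form over `R` in the variables `σ`: a homogeneous polynomial, of some degree. -/
def IsForm {σ R : Type*} [CommSemiring R] (p : MvPolynomial σ R) : Prop :=
  ∃ m : ℕ, p.IsHomogeneous m

/-- `g` is a sum of `r` squares of forms over `R`. As usual, some of the forms may be zero. -/
def IsSumOfSquaresOfForms {σ R : Type*} [CommSemiring R] (r : ℕ) (g : MvPolynomial σ R) : Prop :=
  ∃ p : Fin r → MvPolynomial σ R, (∀ i, IsForm (p i)) ∧ g = ∑ i, p i ^ 2

/-- `g` is nonnegative with respect to every embedding of `k` into the real numbers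
(for `k = ℝ`, where the identity is the only one, this is pointwise nonnegativity). -/
def IsNonnegative {σ k : Type*} [Field k] (g : MvPolynomial σ k) : Prop :=
  ∀ (φ : k →+* ℝ) (x : σ → ℝ), 0 ≤ MvPolynomial.eval₂ φ x g

/-- The assertion of Hilbert's theorem on ternary quartics, over the field `k`: every nonnegative
form of degree four in three variables is a sum of squares of forms. -/
def HilbertTernaryQuartic (k : Type*) [Field k] : Prop :=
  ∀ g : MvPolynomial (Fin 3) k, g.IsHomogeneous 4 → IsNonnegative g →
    ∃ r : ℕ, IsSumOfSquaresOfForms r g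

/-! Take four lines `x + αy + α²z`, where α runs over the roots of the quartic `T⁴ + qT² + qT +
q²/4`. The roots form two complex conjugate pairs, so over ℝ the product of the lines is the squared
modulus of a complex quadratic form, hence a sum of two squares. Each conjugate pair of lines meets
in a real point, where the product vanishes. In a sum of squares over `k` ⊂ ℝ, every summand is the
square of a conic through both points. Their coordinates involve a root `w` of the cubic `X³ - 2qX -
q`, which has no root in `k` if `q` is unramified there. So vanishing at the points splits into six
`k`-linear conditions on the six coefficients, with only the zero solution
(`eq_zero_of_eval_singular_points`). Geometrically, a conic through all six intersection points of
the lines is zero. Even powers of a variable raise the degree: over a real field they cancel from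
sums of squares. Extra variables can be set to zero. -/

/-! ### A cubic without roots in the number field -/

/-- If `q` is a prime that is unramified in `k`, then the Eisenstein cubic `X³ - 2qX - q` has no
root in `k`. -/
theorem exists_prime_forall_cube_ne (k : Type*) [Field k] [NumberField k] :
    ∃ q : ℕ, q.Prime ∧ ∀ x : k, x ^ 3 ≠ 2 * q * x + q := by
  obtain ⟨q, hqd, hq⟩ := Nat.exists_infinite_primes ((NumberField.discr k).natAbs + 1)
  refine ⟨q, hq, fun x hx => ?_⟩
  have hqdvd : ¬ (q : ℤ) ∣ NumberField.discr k := fun h =>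
    absurd (Nat.le_of_dvd (Int.natAbs_pos.2 (NumberField.discr_ne_zero k))
      (Int.natCast_dvd.1 h)) (by omega)
  have hint : IsIntegral ℤ x := by
    refine ⟨Polynomial.X ^ 3 - (Polynomial.C (2 * q : ℤ) * Polynomial.X + Polynomial.C (q : ℤ)),
      Polynomial.monic_X_pow_sub (Polynomial.degree_linear_le.trans_lt (by decide)), ?_⟩
    simp [hx]
  obtain ⟨w, rfl⟩ : ∃ w : NumberField.RingOfIntegers k, (w : k) = x :=
    ⟨⟨x, hint⟩, rfl⟩
  have hw : w ^ 3 = 2 * q * w + q := by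
    apply NumberField.RingOfIntegers.ext
    push_cast
    exact hx
  have hqne : Ideal.span {(q : NumberField.RingOfIntegers k)} ≠ ⊤ := by
    rw [Ne, Ideal.span_singleton_eq_top]
    intro hu
    have h1 := hu.map (Algebra.norm ℤ)
    rw [show (q : NumberField.RingOfIntegers k) = algebraMap ℤ _ (q : ℤ) by simp,
      Algebra.norm_algebraMap] at h1
    rw [isUnit_pow_iff Module.finrank_pos.ne', Int.isUnit_iff] at h1
    have := hq.two_le
    omega
  obtain ⟨P, hP, hqP⟩ := Ideal.exists_le_maximal _ hqne
  have hqP : (q : NumberField.RingOfIntegers k) ∈ P := hqP (Ideal.mem_span_singleton_self _)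
  have hwP : w ∈ P := hP.isPrime.mem_of_pow_mem 3 (by
    rw [hw]; exact P.add_mem (P.mul_mem_right _ (P.mul_mem_left _ hqP)) hqP)
  -- Here `w³ = q(2w + 1)` and `2w + 1` is a unit modulo `P`, so `q` is as divisible by `P` as `w³`:
  -- `P` is ramified over `q`.
  have hqP3 : (q : NumberField.RingOfIntegers k) ∈ P ^ 3 := by
    have h1 : (2 * w + 1) * (q : NumberField.RingOfIntegers k) ∈ P ^ 3 := by
      have := Ideal.pow_mem_pow hwP 3
      rw [hw] at this
      convert this using 1
      ring
    refine ((Ideal.IsPrime.mul_mem_pow (I := P) h1).resolve_left fun h => ?_)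
    refine hP.ne_top ((Ideal.eq_top_iff_one _).2 ?_)
    simpa using P.sub_mem h (P.mul_mem_left 2 hwP)
  have hspan : Ideal.span {(q : ℤ)} ≠ ⊥ := by simpa using hq.ne_zero
  have : (Ideal.span {(q : ℤ)}).IsMaximal :=
    (Ideal.span_singleton_prime (by simpa using hq.ne_zero)).2
      (Nat.prime_iff_prime_int.1 hq) |>.isMaximal hspan
  have hdiff := pow_sub_one_dvd_differentIdeal ℤ P 3 hspan (by
    rw [Ideal.dvd_iff_le, Ideal.map_span, Ideal.span_le]
    simpa using hqP3)
  have hd : (NumberField.discr k : NumberField.RingOfIntegers k) ∈ P :=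
    Ideal.pow_le_self (by norm_num) (Ideal.dvd_iff_le.1 hdiff
      (NumberField.discr_mem_differentIdeal k (NumberField.RingOfIntegers k)))
  obtain ⟨a, b, hab⟩ := (Nat.prime_iff_prime_int.1 hq).coprime_iff_not_dvd.2 hqdvd
  refine hP.ne_top ((Ideal.eq_top_iff_one _).2 ?_)
  have := P.add_mem (P.mul_mem_left (a : NumberField.RingOfIntegers k) hqP)
    (P.mul_mem_left (b : NumberField.RingOfIntegers k) hd)
  rw [show (1 : NumberField.RingOfIntegers k) = ((a * q + b * NumberField.discr k : ℤ) : _) by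
    rw [hab]; simp]
  push_cast
  exact this

open Polynomial in
/-- The powers `1`, `w`, `w²` of a root of a cubic `X³ - cX - d` without roots in `k` are linearly
independent over `k`. -/
theorem eq_zero_of_root_cubic {k L : Type*} [Field k] [Field L] (φ : k →+* L) {c d : k}
    (h : ∀ x : k, x ^ 3 ≠ c * x + d) {w : L} (hw : w ^ 3 = φ c * w + φ d) {a₀ a₁ a₂ : k}
    (ha : φ a₀ + φ a₁ * w + φ a₂ * w ^ 2 = 0) : a₀ = 0 ∧ a₁ = 0 ∧ a₂ = 0 := by
  let := φ.toAlgebra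
  set g : k[X] := X ^ 3 - (C c * X + C d) with hg
  have hlt : (C c * X + C d).degree < 3 := degree_linear_le.trans_lt (by decide)
  have hmon : g.Monic := monic_X_pow_sub hlt
  have hdeg : g.degree = 3 := by
    rw [hg, degree_sub_eq_left_of_degree_lt (by simpa using hlt)]
    simp
  have hirr : Irreducible g := by
    refine irreducible_of_degree_le_three_of_not_isRoot
      (by rw [natDegree_eq_of_degree_eq_some (n := 3) hdeg]; simp) fun x hx => h x ?_
    simpa [hg, IsRoot, sub_eq_zero] using hx
  have hmin : g = minpoly k w := by
    refine minpoly.eq_of_irreducible_of_monic hirr ?_ hmon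
    simp [hg, RingHom.algebraMap_toAlgebra, hw]
  set p : k[X] := C a₂ * X ^ 2 + C a₁ * X + C a₀ with hp
  have hp0 : p = 0 := by
    by_contra hne
    have := minpoly.degree_le_of_ne_zero k w hne (by
      simp only [hp, map_add, map_mul, aeval_C, aeval_X, map_pow, RingHom.algebraMap_toAlgebra]
      linear_combination ha)
    rw [← hmin, hdeg] at this
    exact absurd (this.trans degree_quadratic_le) (by decide)
  refine ⟨?_, ?_, ?_⟩
  · simpa [hp] using congrArg (coeff · 0) hp0
  · simpa [hp, coeff_X, coeff_C] using congrArg (coeff · 1) hp0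
  · simpa [hp, coeff_X, coeff_C] using congrArg (coeff · 2) hp0

/-! ### Conics through the two real singular points -/

open MvPolynomial

/-- A ternary quadratic form has six coefficients. -/
theorem MvPolynomial.IsHomogeneous.exists_eq_ternary_quadratic {R : Type*} [CommRing R]
    {p : MvPolynomial (Fin 3) R} (hp : p.IsHomogeneous 2) :
    ∃ a b c d e f : R, p = C a * X 0 ^ 2 + C b * X 1 ^ 2 + C c * X 2 ^ 2
      + C d * (X 0 * X 1) + C e * (X 0 * X 2) + C f * (X 1 * X 2) := by
  rw [p.as_sum]
  refine Finset.sum_induction _ (fun p : MvPolynomial (Fin 3) R => ∃ a b c d e f : R,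
    p = C a * X 0 ^ 2 + C b * X 1 ^ 2 + C c * X 2 ^ 2
      + C d * (X 0 * X 1) + C e * (X 0 * X 2) + C f * (X 1 * X 2)) ?_ ?_ ?_
  · rintro _ _ ⟨a, b, c, d, e, f, rfl⟩ ⟨a', b', c', d', e', f', rfl⟩
    refine ⟨a + a', b + b', c + c', d + d', e + e', f + f', ?_⟩
    simp only [C_add]
    ring
  · exact ⟨0, 0, 0, 0, 0, 0, by simp⟩
  · intro s hs
    have hdeg : s 0 + s 1 + s 2 = 2 := by
      rw [← Fin.sum_univ_three, ← Finsupp.degree_eq_sum]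
      by_contra h
      exact mem_support_iff.1 hs (hp.coeff_eq_zero h)
    rw [monomial_eq, Finsupp.prod_fintype _ _ (by simp), Fin.prod_univ_three]
    generalize coeff s p = t
    generalize s 0 = i at *
    generalize s 1 = j at *
    generalize s 2 = l at *
    obtain ⟨rfl, rfl, rfl⟩ | ⟨rfl, rfl, rfl⟩ | ⟨rfl, rfl, rfl⟩ | ⟨rfl, rfl, rfl⟩ | ⟨rfl, rfl, rfl⟩ |
      ⟨rfl, rfl, rfl⟩ : (i = 2 ∧ j = 0 ∧ l = 0) ∨ (i = 0 ∧ j = 2 ∧ l = 0) ∨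
        (i = 0 ∧ j = 0 ∧ l = 2) ∨ (i = 1 ∧ j = 1 ∧ l = 0) ∨ (i = 1 ∧ j = 0 ∧ l = 1) ∨
        (i = 0 ∧ j = 1 ∧ l = 1) := by omega
    · exact ⟨t, 0, 0, 0, 0, 0, by simp⟩
    · exact ⟨0, t, 0, 0, 0, 0, by simp⟩
    · exact ⟨0, 0, t, 0, 0, 0, by simp⟩
    · exact ⟨0, 0, 0, t, 0, 0, by simp⟩
    · exact ⟨0, 0, 0, 0, t, 0, by simp⟩
    · exact ⟨0, 0, 0, 0, 0, t, by simp⟩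

/-- Let `w` be a real root of `X³ - 2qX - q`, a cubic without roots in `k`, and `r² = w² - 2q`.
A quadratic form over `k` that vanishes at the two real singular points of
`quarticNormForm q q (q² / 4)` is zero. -/
theorem eq_zero_of_eval_singular_points {k : Type*} [Field k] [CharZero k] (φ : k →+* ℝ) {q : ℕ}
    (hq0 : q ≠ 0) (hq : ∀ x : k, x ^ 3 ≠ 2 * q * x + q) {w r : ℝ} (hw : w ^ 3 = 2 * q * w + q)
    (hr : r ^ 2 = w ^ 2 - 2 * q) (hr0 : r ≠ 0) {p : MvPolynomial (Fin 3) k}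
    (hp : p.IsHomogeneous 2) (h₁ : eval₂ φ ![(w ^ 2 - q + r * w) / 2, -r, 1] p = 0)
    (h₂ : eval₂ φ ![(w ^ 2 - q - r * w) / 2, r, 1] p = 0) : p = 0 := by
  obtain ⟨a, b, c, d, e, f, rfl⟩ := hp.exists_eq_ternary_quadratic
  simp only [eval₂_add, eval₂_mul, eval₂_C, eval₂_pow, eval₂_X, Matrix.cons_val_zero,
    Matrix.cons_val_one, Matrix.cons_val] at h₁ h₂
  have hqk : (q : k) ≠ 0 := by exact_mod_cast hq0
  have hq' : ∀ x : k, x ^ 3 ≠ (2 * q) * x + q := hq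
  have hw' : w ^ 3 = φ (2 * q) * w + φ q := by
    rw [map_mul, map_ofNat, map_natCast]; exact hw
  -- The points are exchanged by `r ↦ -r`: the difference of the two equations isolates the part odd
  -- in `r`, their sum the even part. Thus it does not matter whether `r` lies in `k(w)`.
  have hodd : φ (a * q + d * q - 2 * f) + φ (a * q + e) * w + φ (- d) * w ^ 2 = 0 := by
    simp only [map_add, map_sub, map_mul, map_neg, map_ofNat, map_natCast]
    refine mul_left_cancel₀ hr0 ?_
    linear_combination h₁ - h₂ - φ a * r * hw
  obtain ⟨h3, h4, h5⟩ := eq_zero_of_root_cubic φ hq' hw' hodd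
  obtain rfl : d = 0 := by simpa using h5
  have heven : φ (a * q ^ 2 / 4 - 2 * q * b + c - e * q / 2) + φ (a * q / 2) * w +
      φ (b + e / 2) * w ^ 2 = 0 := by
    simp only [map_add, map_sub, map_mul, map_div₀, map_pow, map_ofNat, map_natCast]
    simp only [map_zero] at h₁ h₂
    linear_combination (h₁ + h₂) / 2 - (φ a * w ^ 2 / 4 + φ b) * hr - φ a * w / 2 * hw
  obtain ⟨h6, h7, h8⟩ := eq_zero_of_root_cubic φ hq' hw' heven
  obtain rfl : a = 0 := by simpa [hqk] using h7
  obtain rfl : e = 0 := by simpa using h4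
  obtain rfl : f = 0 := by simpa using h3
  obtain rfl : b = 0 := by simpa using h8
  obtain rfl : c = 0 := by simpa using h6
  simp

/-! ### The norm form, its real factors and its two squares -/

/-- The product of the linear forms `x + αy + α²z`, where `α` runs over the roots of
`T⁴ + aT² + bT + c`. -/
noncomputable def quarticNormForm {R : Type*} [CommRing R] (a b c : R) : MvPolynomial (Fin 3) R :=
  X 0 ^ 4 - C (2 * a) * (X 0 ^ 3 * X 2) + C (a ^ 2 + 2 * c) * (X 0 ^ 2 * X 2 ^ 2)
    + C a * (X 0 ^ 2 * X 1 ^ 2) + C (3 * b) * (X 0 ^ 2 * (X 1 * X 2))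
    + C (b ^ 2 - 2 * a * c) * (X 0 * X 2 ^ 3) - C b * (X 0 * X 1 ^ 3)
    - C (a * b) * (X 0 * (X 1 * X 2 ^ 2)) - C (4 * c) * (X 0 * (X 1 ^ 2 * X 2))
    + C (c ^ 2) * X 2 ^ 4 + C c * X 1 ^ 4 + C (a * c) * (X 1 ^ 2 * X 2 ^ 2)
    - C (b * c) * (X 1 * X 2 ^ 3)

section quarticNormForm

variable {R S : Type*} [CommRing R] [CommRing S]

theorem isHomogeneous_quarticNormForm (a b c : R) : (quarticNormForm a b c).IsHomogeneous 4 := by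
  have hX (i : Fin 3) (n : ℕ) : (X i ^ n : MvPolynomial (Fin 3) R).IsHomogeneous n :=
    isHomogeneous_X_pow i n
  have hX1 (i : Fin 3) : (X i : MvPolynomial (Fin 3) R).IsHomogeneous 1 := isHomogeneous_X R i
  unfold quarticNormForm
  refine .sub (.add (.add (.add (.sub (.sub (.sub (.add (.add (.add (.add (.sub (hX 0 4) ?_) ?_)
    ?_) ?_) ?_) ?_) ?_) ?_) ?_) ?_) ?_) ?_ <;> refine IsHomogeneous.C_mul ?_ _
  · exact (hX 0 3).mul (hX1 2)
  · exact (hX 0 2).mul (hX 2 2)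
  · exact (hX 0 2).mul (hX 1 2)
  · exact (hX 0 2).mul ((hX1 1).mul (hX1 2))
  · exact (hX1 0).mul (hX 2 3)
  · exact (hX1 0).mul (hX 1 3)
  · exact (hX1 0).mul ((hX1 1).mul (hX 2 2))
  · exact (hX1 0).mul ((hX 1 2).mul (hX1 2))
  · exact hX 2 4
  · exact hX 1 4
  · exact (hX 1 2).mul (hX 2 2)
  · exact (hX1 1).mul (hX 2 3)

theorem map_quarticNormForm (φ : R →+* S) (a b c : R) :
    map φ (quarticNormForm a b c) = quarticNormForm (φ a) (φ b) (φ c) := by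
  simp only [quarticNormForm, map_add, map_sub, map_mul, map_pow, map_X, map_C, map_ofNat]

theorem quarticNormForm_ne_zero [Nontrivial R] (a b c : R) : quarticNormForm a b c ≠ 0 := by
  intro h
  simpa [quarticNormForm] using congrArg (eval ![1, 0, 0]) h

/-- The norm form of a product of two quadratic polynomials is the product of the norm forms. -/
theorem eval_quarticNormForm (r e e' : R) (v : Fin 3 → R) :
    eval v (quarticNormForm (e + e' - r ^ 2) (r * (e - e')) (e * e')) =
      (v 0 ^ 2 + r * v 0 * v 1 + (r ^ 2 - 2 * e) * v 0 * v 2 + e * v 1 ^ 2 + e * r * v 1 * v 2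
        + e ^ 2 * v 2 ^ 2) *
      (v 0 ^ 2 - r * v 0 * v 1 + (r ^ 2 - 2 * e') * v 0 * v 2 + e' * v 1 ^ 2
        - e' * r * v 1 * v 2 + e' ^ 2 * v 2 ^ 2) := by
  simp only [quarticNormForm, map_add, map_sub, map_mul, map_pow, eval_X, eval_C]
  ring

end quarticNormForm

/-- If `T⁴ + aT² + bT + c = (T² - rT + e)(T² + rT + e')` with two quadratic factors without real
roots, then the norm form is a sum of two squares of quadratic forms. -/
theorem exists_quarticNormForm_eq_sum_two_sq {r e e' : ℝ} (he : r ^ 2 ≤ 4 * e)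
    (he' : r ^ 2 ≤ 4 * e') :
    ∃ A B : MvPolynomial (Fin 3) ℝ, A.IsHomogeneous 2 ∧ B.IsHomogeneous 2 ∧
      quarticNormForm (e + e' - r ^ 2) (r * (e - e')) (e * e') = A ^ 2 + B ^ 2 := by
  have hX (i : Fin 3) : (X i : MvPolynomial (Fin 3) ℝ).IsHomogeneous 1 := isHomogeneous_X ℝ i
  obtain ⟨s, hs⟩ : ∃ s : ℝ, s ^ 2 = e - r ^ 2 / 4 := ⟨_, Real.sq_sqrt (by linarith)⟩
  obtain ⟨s', hs'⟩ : ∃ s : ℝ, s ^ 2 = e' - r ^ 2 / 4 := ⟨_, Real.sq_sqrt (by linarith)⟩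
  -- `P + iQ` and `P' + iQ'` are the linear forms at the roots `r/2 + is` and `-r/2 + is'`; the two
  -- squares come from their product.
  set P : MvPolynomial (Fin 3) ℝ := X 0 + C (r / 2) * X 1 + C ((r ^ 2 - 2 * e) / 2) * X 2 with hP
  set P' : MvPolynomial (Fin 3) ℝ :=
    X 0 + C (-r / 2) * X 1 + C ((r ^ 2 - 2 * e') / 2) * X 2 with hP'
  set Q : MvPolynomial (Fin 3) ℝ := C s * (X 1 + C r * X 2) with hQ
  set Q' : MvPolynomial (Fin 3) ℝ := C s' * (X 1 + C (-r) * X 2) with hQ'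
  have h1 : P.IsHomogeneous 1 := ((hX 0).add ((hX 1).C_mul _)).add ((hX 2).C_mul _)
  have h2 : P'.IsHomogeneous 1 := ((hX 0).add ((hX 1).C_mul _)).add ((hX 2).C_mul _)
  have h3 : Q.IsHomogeneous 1 := ((hX 1).add ((hX 2).C_mul _)).C_mul _
  have h4 : Q'.IsHomogeneous 1 := ((hX 1).add ((hX 2).C_mul _)).C_mul _
  refine ⟨P * P' - Q * Q', P * Q' + Q * P', (h1.mul h2).sub (h3.mul h4),
    (h1.mul h4).add (h3.mul h2), ?_⟩
  rw [show (P * P' - Q * Q') ^ 2 + (P * Q' + Q * P') ^ 2 = (P ^ 2 + Q ^ 2) * (P' ^ 2 + Q' ^ 2) by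
    ring]
  refine MvPolynomial.funext fun v => ?_
  rw [eval_quarticNormForm]
  simp only [hP, hP', hQ, hQ', map_add, map_mul, map_pow, eval_X, eval_C, mul_pow, hs, hs']
  ring

/-- The real parameters describing the real singular points of the norm form of
`T⁴ + qT² + qT + q²/4`. -/
theorem exists_real_parameters {q : ℝ} (hq : 2 ≤ q) :
    ∃ w r : ℝ, w ^ 3 = 2 * q * w + q ∧ r ^ 2 = w ^ 2 - 2 * q ∧ 0 < w ∧ 0 < r ∧ 2 * r ≤ w := by
  obtain ⟨w, ⟨hw0, -⟩, hw⟩ : ∃ w ∈ Set.Icc 0 (2 * q), w ^ 3 - 2 * q * w = q := by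
    have hc : ContinuousOn (fun w : ℝ => w ^ 3 - 2 * q * w) (Set.Icc 0 (2 * q)) := by fun_prop
    refine intermediate_value_Icc (by linarith) hc ⟨by simp; linarith, ?_⟩
    have : 0 ≤ q ^ 2 * (q - 2) := mul_nonneg (sq_nonneg q) (by linarith)
    show q ≤ (2 * q) ^ 3 - 2 * q * (2 * q)
    nlinarith
  have hwpos : 0 < w := hw0.lt_of_ne (by rintro rfl; linarith)
  have hθ : w * (w ^ 2 - 2 * q) = q := by linear_combination hw
  have hθpos : 0 < w ^ 2 - 2 * q := pos_of_mul_pos_right (by rw [hθ]; linarith) hw0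
  have hw2 : 2 ≤ w := by nlinarith
  refine ⟨w, √(w ^ 2 - 2 * q), by linear_combination hw, Real.sq_sqrt hθpos.le, hwpos,
    Real.sqrt_pos.2 hθpos, ?_⟩
  -- With `u = w² - 2q` one has `uw = q` and `w ≥ 2`, so `4u ≤ 2q ≤ w²`.
  have h2 : 2 * (w ^ 2 - 2 * q) ≤ q := by nlinarith
  refine abs_le_of_sq_le_sq' ?_ hw0 |>.2
  rw [mul_pow, Real.sq_sqrt hθpos.le]
  linarith

/-! ### Cancelling variables and normalizing degrees -/

/-- A sum of squares of polynomials over a real field is zero only if all of them are zero. -/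
theorem eq_zero_of_sum_sq_eq_zero {σ k ι : Type*} [Field k] [Fintype ι] (φ : k →+* ℝ)
    {p : ι → MvPolynomial σ k} (h : ∑ i, p i ^ 2 = 0) (i : ι) : p i = 0 := by
  refine map_injective φ φ.injective ?_
  rw [map_zero]
  refine MvPolynomial.funext fun v => ?_
  have := congrArg (fun p => eval v (map φ p)) h
  simp only [map_sum, map_pow, map_zero] at this
  simpa using (Finset.sum_eq_zero_iff_of_nonneg fun i _ => sq_nonneg _).1 this i (Finset.mem_univ i)

/-- Substituting zero for the variable `X j` changes a polynomial by a multiple of `X j`. -/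
theorem X_dvd_sub_aeval_update {σ R : Type*} [CommRing R] [DecidableEq σ] (j : σ)
    (p : MvPolynomial σ R) : X j ∣ p - aeval (Function.update X j 0) p := by
  induction p using MvPolynomial.induction_on with
  | C a => simp
  | add p q hp hq => rw [map_add, add_sub_add_comm]; exact dvd_add hp hq
  | mul_X p i hp =>
    rw [map_mul, aeval_X]
    rcases eq_or_ne i j with rfl | hij
    · simp
    · rw [Function.update_of_ne hij, ← sub_mul]
      exact hp.mul_right _

theorem isHomogeneous_of_X_mul {σ R : Type*} [CommSemiring R] {j : σ} {p : MvPolynomial σ R}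
    {m : ℕ} (h : (X j * p).IsHomogeneous (m + 1)) : p.IsHomogeneous m := by
  intro s hs
  have := @h (Finsupp.single j 1 + s) (by rwa [coeff_X_mul])
  rw [map_add, Finsupp.weight_single] at this
  simp at this
  omega

/-- If a square of a variable divides a sum of squares of forms over a real field, then it can be
cancelled. -/
theorem exists_sum_sq_of_X_sq_mul {σ k ι : Type*} [Field k] [Fintype ι] (φ : k →+* ℝ) {j : σ}
    {g : MvPolynomial σ k} {m : ℕ} {p : ι → MvPolynomial σ k}
    (hp : ∀ i, (p i).IsHomogeneous (m + 1)) (h : X j ^ 2 * g = ∑ i, p i ^ 2) :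
    ∃ p' : ι → MvPolynomial σ k, (∀ i, (p' i).IsHomogeneous m) ∧ g = ∑ i, p' i ^ 2 := by
  classical
  have hdvd (i : ι) : X j ∣ p i := by
    -- Setting `X j = 0` kills the left side, hence every summand.
    have h0 := congrArg (aeval (Function.update X j (0 : MvPolynomial σ k))) h
    simp only [map_sum, map_pow, map_mul, aeval_X, Function.update_self] at h0
    have := eq_zero_of_sum_sq_eq_zero φ
      (p := fun i => aeval (Function.update X j (0 : MvPolynomial σ k)) (p i))
      (by rw [← h0]; simp) i
    rw [← sub_zero (p i), ← this]
    exact X_dvd_sub_aeval_update j (p i)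
  choose p' hp' using hdvd
  refine ⟨p', fun i => isHomogeneous_of_X_mul (hp' i ▸ hp i), ?_⟩
  refine mul_left_cancel₀ (pow_ne_zero 2 (X_ne_zero j)) ?_
  rw [h, Finset.mul_sum]
  simp [hp', mul_pow]

/-- In a representation of a form of degree `2m` as a sum of squares of forms, the forms may be
taken of degree `m`. -/
theorem IsSumOfSquaresOfForms.exists_isHomogeneous {σ R : Type*} [CommSemiring R] {r m : ℕ}
    {g : MvPolynomial σ R} (hg : g.IsHomogeneous (2 * m)) (h : IsSumOfSquaresOfForms r g) :
    ∃ p : Fin r → MvPolynomial σ R, (∀ i, (p i).IsHomogeneous m) ∧ g = ∑ i, p i ^ 2 := by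
  obtain ⟨p, hp, hsum⟩ := h
  refine ⟨fun i => homogeneousComponent m (p i),
    fun i => homogeneousComponent_isHomogeneous m (p i), ?_⟩
  rw [← homogeneousComponent_eq_self hg, hsum, map_sum]
  refine Finset.sum_congr rfl fun i _ => ?_
  obtain ⟨l, hl⟩ := hp i
  dsimp only
  rw [homogeneousComponent_of_mem hl, homogeneousComponent_of_mem (hl.pow 2)]
  by_cases hlm : m = l
  · simp [hlm, mul_comm]
  · rw [if_neg hlm, if_neg (by omega)]
    simp

/-! ### The rational quartic -/

/-- The rational quartic form attached to a prime `q`. -/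
noncomputable def rationalQuartic (q : ℕ) : MvPolynomial (Fin 3) ℚ :=
  quarticNormForm (q : ℚ) (q : ℚ) ((q : ℚ) ^ 2 / 4)

/-- The resolvent cubic for `u = r²` is `u³ + 2au² + (a² - 4c)u - b²`. The constant term `q²/4`
removes its linear term, and `u = q/w` turns it into the cubic of `w`. -/
theorem map_rationalQuartic {w r : ℝ} {q : ℕ} (hw : w ^ 3 = 2 * q * w + q)
    (hr : r ^ 2 = w ^ 2 - 2 * q) : map (algebraMap ℚ ℝ) (rationalQuartic q) =
      quarticNormForm ((w ^ 2 - q + r * w) / 2 + (w ^ 2 - q - r * w) / 2 - r ^ 2)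
        (r * ((w ^ 2 - q + r * w) / 2 - (w ^ 2 - q - r * w) / 2))
        ((w ^ 2 - q + r * w) / 2 * ((w ^ 2 - q - r * w) / 2)) := by
  rw [rationalQuartic, map_quarticNormForm]
  simp only [map_natCast, map_div₀, map_pow, map_ofNat]
  congr 1
  · linear_combination hr
  · linear_combination -w * hr - hw
  · linear_combination w ^ 2 / 4 * hr

theorem exists_sum_two_sq_rationalQuartic {q : ℕ} (hq : 2 ≤ q) :
    ∃ A B : MvPolynomial (Fin 3) ℝ, A.IsHomogeneous 2 ∧ B.IsHomogeneous 2 ∧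
      map (algebraMap ℚ ℝ) (rationalQuartic q) = A ^ 2 + B ^ 2 := by
  obtain ⟨w, r, hw, hr, hw0, hr0, hrw⟩ := exists_real_parameters (q := q) (by exact_mod_cast hq)
  rw [map_rationalQuartic hw hr]
  -- For the factor with the minus sign, the discriminant condition amounts to `2rw ≤ w²`.
  apply exists_quarticNormForm_eq_sum_two_sq <;> nlinarith

/-- The quartic form is not a sum of squares over `k`. -/
theorem rationalQuartic_ne_sum_sq {k ι : Type*} [Field k] [CharZero k] [Fintype ι] (φ : k →+* ℝ)
    {q : ℕ} (hq2 : 2 ≤ q) (hq : ∀ x : k, x ^ 3 ≠ 2 * q * x + q) {p : ι → MvPolynomial (Fin 3) k}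
    (hp : ∀ i, (p i).IsHomogeneous 2) :
    map (algebraMap ℚ k) (rationalQuartic q) ≠ ∑ i, p i ^ 2 := by
  intro h
  obtain ⟨w, r, hw, hr, hw0, hr0, hrw⟩ := exists_real_parameters (q := q) (by exact_mod_cast hq2)
  have hvan (v : Fin 3 → ℝ) (hv : eval v (map (algebraMap ℚ ℝ) (rationalQuartic q)) = 0) (i : ι) :
      eval₂ φ v (p i) = 0 := by
    have h0 := congrArg (eval₂ φ v) h
    rw [eval₂_sum, eval₂_map,
      Subsingleton.elim (φ.comp (algebraMap ℚ k)) (algebraMap ℚ ℝ), ← eval_map, hv] at h0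
    simp only [eval₂_pow] at h0
    simpa using (Finset.sum_eq_zero_iff_of_nonneg fun i _ => sq_nonneg _).1 h0.symm i
      (Finset.mem_univ i)
  rw [map_rationalQuartic hw hr] at hvan
  have hp0 (i : ι) : p i = 0 := by
    -- At `(e, -r, 1)` the form of α takes the value `α² - rα + e`, so both lines of a conjugate
    -- pair vanish; likewise at `(e', r, 1)`.
    refine eq_zero_of_eval_singular_points φ (by omega) hq hw hr hr0.ne' (hp i)
      (hvan _ ?_ i) (hvan _ ?_ i)
    · rw [eval_quarticNormForm]
      simp only [Matrix.cons_val_zero, Matrix.cons_val_one, Matrix.cons_val]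
      ring
    · rw [eval_quarticNormForm]
      simp only [Matrix.cons_val_zero, Matrix.cons_val_one, Matrix.cons_val]
      ring
  simp only [hp0] at h
  refine quarticNormForm_ne_zero (R := ℚ) _ _ _
    (map_injective (algebraMap ℚ k) (algebraMap ℚ k).injective (h.trans ?_))
  simp

/-- Multiplying the quartic form by an even power of a variable does not make it a sum of
squares over `k`. -/
theorem X_pow_mul_rationalQuartic_ne_sum_sq {k ι : Type*} [Field k] [CharZero k] [Fintype ι]
    (φ : k →+* ℝ) {q : ℕ} (hq2 : 2 ≤ q) (hq : ∀ x : k, x ^ 3 ≠ 2 * q * x + q) (e : ℕ) :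
    ∀ p : ι → MvPolynomial (Fin 3) k, (∀ i, (p i).IsHomogeneous (2 + e)) →
      (X 0 ^ e) ^ 2 * map (algebraMap ℚ k) (rationalQuartic q) ≠ ∑ i, p i ^ 2 := by
  induction e with
  | zero => intro p hp; simpa using rationalQuartic_ne_sum_sq φ hq2 hq hp
  | succ e ih =>
    intro p hp h
    obtain ⟨p', hp', h'⟩ := exists_sum_sq_of_X_sq_mul (j := 0) (m := 2 + e) φ hp
      (g := (X 0 ^ e) ^ 2 * map (algebraMap ℚ k) (rationalQuartic q)) (by rw [← h]; ring)
    exact ih p' hp' h'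

/-! ### All even degrees and all numbers of variables -/

theorem exists_form_sum_two_sq_not_sum_sq {k : Type*} [Field k] [CharZero k] (φ : k →+* ℝ)
    {q : ℕ} (hq2 : 2 ≤ q) (hq : ∀ x : k, x ^ 3 ≠ 2 * q * x + q) {n d : ℕ} (hn : 2 ≤ n)
    (hd : 4 ≤ d) (hde : Even d) :
    ∃ f : MvPolynomial (Fin (n + 1)) ℚ, f.IsHomogeneous d ∧
      IsSumOfSquaresOfForms 2 (map (algebraMap ℚ ℝ) f) ∧
      ¬ ∃ r : ℕ, IsSumOfSquaresOfForms r (map (algebraMap ℚ k) f) := by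
  obtain ⟨e, rfl⟩ : ∃ e, d = 2 * (2 + e) := by
    obtain ⟨m, rfl⟩ := hde
    exact ⟨m - 2, by omega⟩
  have hhom : ((X 0 ^ e) ^ 2 * rationalQuartic q).IsHomogeneous (2 * (2 + e)) := by
    have := ((isHomogeneous_X_pow (R := ℚ) (0 : Fin 3) e).pow 2).mul
      (isHomogeneous_quarticNormForm (q : ℚ) (q : ℚ) ((q : ℚ) ^ 2 / 4))
    rwa [show e * 2 + 4 = 2 * (2 + e) by ring] at this
  refine ⟨rename (Fin.castLE (by omega : 3 ≤ n + 1)) ((X 0 ^ e) ^ 2 * rationalQuartic q),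
    hhom.rename_isHomogeneous, ?_, ?_⟩
  · obtain ⟨A, B, hA, hB, hAB⟩ := exists_sum_two_sq_rationalQuartic hq2
    have hX := isHomogeneous_X_pow (R := ℝ) (0 : Fin 3) e
    rw [map_rename, map_mul, hAB]
    refine ⟨![rename (Fin.castLE (by omega)) (X 0 ^ e * A), rename (Fin.castLE (by omega)) (X 0 ^ e * B)], ?_, ?_⟩
    · intro i
      fin_cases i
      · exact ⟨_, (hX.mul hA).rename_isHomogeneous⟩
      · exact ⟨_, (hX.mul hB).rename_isHomogeneous⟩
    · rw [Fin.sum_univ_two, map_pow, map_pow, map_X]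
      simp only [Matrix.cons_val_zero, Matrix.cons_val_one, ← map_pow, ← map_add]
      congr 1
      ring
  · rintro ⟨r, hr⟩
    obtain ⟨p, hp, hsum⟩ := hr.exists_isHomogeneous (hhom.rename_isHomogeneous.map _)
    -- Setting the extra variables to zero is a left inverse of the renaming and preserves degrees
    -- of forms.
    set ρ : MvPolynomial (Fin (n + 1)) k →ₐ[k] MvPolynomial (Fin 3) k :=
      aeval (fun j => if h : (j : ℕ) < 3 then X ⟨j, h⟩ else 0) with hρ
    refine X_pow_mul_rationalQuartic_ne_sum_sq φ hq2 hq e (fun i => ρ (p i)) (fun i => ?_) ?_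
    · have := (hp i).aeval (n := 1) (fun j : Fin (n + 1) =>
        if h : (j : ℕ) < 3 then (X ⟨j, h⟩ : MvPolynomial (Fin 3) k) else 0) (fun j => by
          split_ifs
          · exact isHomogeneous_X _ _
          · exact isHomogeneous_zero _ _ _)
      rwa [one_mul] at this
    · have := congrArg ρ hsum
      rw [map_rename, hρ, aeval_rename, map_sum] at this
      simp only [map_pow] at this
      rw [← this]
      have hid : ((fun j : Fin (n + 1) => if h : (j : ℕ) < 3 then
          (X ⟨j, h⟩ : MvPolynomial (Fin 3) k) else 0) ∘ Fin.castLE (by omega : 3 ≤ n + 1)) = X := by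
        funext j
        simp
      rw [hid, aeval_X_left, AlgHom.id_apply]
      simp

theorem corollary2p11 (k : Type*) [Field k] [NumberField k]
    (hk : ∃ v : NumberField.InfinitePlace k, v.IsReal) :
    (∀ n d : ℕ, 2 ≤ n → 4 ≤ d → Even d →
      ∃ f : MvPolynomial (Fin (n + 1)) ℚ, f.IsHomogeneous d ∧
        IsSumOfSquaresOfForms 2 (MvPolynomial.map (algebraMap ℚ ℝ) f) ∧
        ¬ ∃ r : ℕ, IsSumOfSquaresOfForms r (MvPolynomial.map (algebraMap ℚ k) f)) ∧
    ¬ HilbertTernaryQuartic k := by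
  obtain ⟨v, hv⟩ := hk
  obtain ⟨q, hq, hroot⟩ := exists_prime_forall_cube_ne k
  have main := fun n d hn hd hde => exists_form_sum_two_sq_not_sum_sq (n := n) (d := d)
    (NumberField.InfinitePlace.embedding_of_isReal hv) hq.two_le hroot hn hd hde
  refine ⟨main, fun hH => ?_⟩
  obtain ⟨f, hf, ⟨p, -, hsum⟩, hnot⟩ := main 2 4 le_rfl le_rfl ⟨2, rfl⟩
  refine hnot (hH _ (hf.map _) fun φ x => ?_)
  -- All embeddings agree on ℚ, so the one real identity gives nonnegativity for each of them.
  rw [eval₂_map, Subsingleton.elim (φ.comp (algebraMap ℚ k)) (algebraMap ℚ ℝ), ← eval_map, hsum,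
    map_sum]
  exact Finset.sum_nonneg fun i _ => by rw [map_pow]; exact sq_nonneg _
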